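/- A rooted plane tree $t$ consists of a root and an ordered (possibly empty) finite sequence of branches, which are again rooted plane trees; a leaf is a vertex without children (so the root of the one-vertex tree is a leaf). For an integer $k\ge 0$, $t$ is called $k$-protected if the distance of its root to every leaf is at least $k$. For $n\ge 1$, let $r_{nk}$ be the number of $k$-protected rooted plane trees with $n$ vertices, and let $X_n$ be the protection number, i.e. the minimal distance of the root to a leaf, of a uniformly chosen random rooted plane tree with $n$ vertices; thus $\mathbb{P}(X_n\ge k)$ is the probability that a random rooted plane tree with $n$ vertices is $k$-protected. Then $$\mathbb{P}(X_n\ge k)=\frac{9\cdot 4^k}{(4^k+2)^2}+\frac{9\cdot 4^k\bigl((3k-8)4^{2k}+28\cdot 4^k-(12k+20)\bigr)}{2(4^k+2)^4}\cdot\frac1n+O\Bigl(\frac{k^2}{3^k n^{3/2}}\Bigr),$$ where the implied constant is absolute, i.e. the estimate is uniform in all integers $n\ge 1$ and $k\ge 0$. Moreover, for every complex $z$ with $0<|z|<\tfrac14$, put $R_0(z)=\frac{1-\sqrt{1-4z}}{2}$ with the principal square root. Then the generating functions $R_{\ge k}(z)=\sum_{n\ge 1} r_{nk}z^n$ converge,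 $R_{\ge 0}(z)=R_0(z)$, and for every $k\ge 1$ one has $1+z^{k-2}R_0(z)^3\neq 0$ and $$R_{\ge k}(z)=\frac{(1-z)z^{k-2}R_0(z)^3}{1+z^{k-2}R_0(z)^3}.$$ -/

import Mathlib

/-- Rooted plane trees: a root together with the ordered list of its branches. -/
inductive PlaneTree : Type
  | node : List PlaneTree → PlaneTree

namespace PlaneTree

/-- The number of vertices of a plane tree. -/
def numVertices : PlaneTree → ℕ
  | node ts => 1 + (ts.map numVertices).sum

/-- `t.HasLeafAtDepth d` : some leaf (vertex without children) of `t` is at distance `d` from the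
root of `t`. A tree with a single vertex is itself a leaf. -/
inductive HasLeafAtDepth : PlaneTree → ℕ → Prop
  | leaf : HasLeafAtDepth (node []) 0
  | branch {ts : List PlaneTree} {t : PlaneTree} {d : ℕ} (ht : t ∈ ts)
      (hd : HasLeafAtDepth t d) : HasLeafAtDepth (node ts) (d + 1)

/-- The protection number of a tree: the minimal distance of the root to a leaf. -/
noncomputable def protectionNumber (t : PlaneTree) : ℕ :=
  sInf {d : ℕ | t.HasLeafAtDepth d}

/-- The minimum defining the protection number is over a nonempty set. -/
theorem exists_hasLeafAtDepth : ∀ t : PlaneTree, ∃ d : ℕ, t.HasLeafAtDepth d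
  | node [] => ⟨0, .leaf⟩
  | node (t :: _) =>
    let ⟨d, hd⟩ := exists_hasLeafAtDepth t
    ⟨d + 1, .branch List.mem_cons_self hd⟩

/-- A tree is `k`-protected if the distance of its root to every leaf is at least `k`. -/
def IsProtected (k : ℕ) (t : PlaneTree) : Prop :=
  ∀ d : ℕ, t.HasLeafAtDepth d → k ≤ d

/-- A tree is `k`-protected if and only if its protection number is at least `k`. -/
theorem isProtected_iff (k : ℕ) (t : PlaneTree) : t.IsProtected k ↔ k ≤ t.protectionNumber :=
  ⟨fun h => h _ (Nat.sInf_mem t.exists_hasLeafAtDepth), fun h _ hd => h.trans (Nat.sInf_le hd)⟩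

/-- The set of plane trees with `n` vertices. -/
def ofSize (n : ℕ) : Set PlaneTree := {t | t.numVertices = n}

/-- There are finitely many plane trees with at most `n` vertices. -/
theorem finite_numVertices_le (n : ℕ) : {t : PlaneTree | t.numVertices ≤ n}.Finite := by
  induction n with
  | zero =>
    refine Set.Finite.subset Set.finite_empty ?_
    rintro ⟨ts⟩ h
    simp [numVertices] at h
  | succ n ih =>
    have : Finite {t : PlaneTree | t.numVertices ≤ n} := ih
    refine ((List.finite_length_le {t : PlaneTree | t.numVertices ≤ n} n).image
      fun l => node (l.map Subtype.val)).subset ?_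
    rintro ⟨ts⟩ h
    have h' : (ts.map numVertices).sum ≤ n := by
      simp only [Set.mem_ofPred_eq, numVertices] at h
      omega
    have hmem : ∀ t ∈ ts, t.numVertices ≤ n := fun t ht =>
      (List.single_le_sum (by simp) _ (List.mem_map_of_mem ht)).trans h'
    have hlen : ts.length ≤ (ts.map numVertices).sum := by
      have := List.length_le_sum_of_one_le (ts.map numVertices) (by
        intro i hi
        obtain ⟨⟨us⟩, -, rfl⟩ := List.mem_map.1 hi
        simp [numVertices])
      simpa using this
    refine ⟨ts.attach.map fun t => ⟨t.1, hmem t.1 t.2⟩, ?_, ?_⟩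
    · simpa using hlen.trans h'
    · simp [Function.comp_def]

/-- There are finitely many plane trees with `n` vertices. -/
theorem finite_ofSize (n : ℕ) : (ofSize n).Finite :=
  (finite_numVertices_le n).subset fun _ h => le_of_eq h

/-- The discrete `σ`-algebra on the countable set of plane trees. -/
instance : MeasurableSpace PlaneTree := ⊤

instance : DiscreteMeasurableSpace PlaneTree := ⟨fun _ => trivial⟩

/-- The number of `k`-protected plane trees with `n` vertices. -/
noncomputable def numProtected (n k : ℕ) : ℕ := {t ∈ ofSize n | t.IsProtected k}.ncard

/-- The law of a uniformly chosen random plane tree with `n` vertices. -/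
noncomputable def uniformTree (n : ℕ) : MeasureTheory.Measure PlaneTree :=
  ProbabilityTheory.uniformOn (ofSize n)

/-- For `n ≥ 1` the law of a random plane tree with `n` vertices is a probability measure. -/
theorem isProbabilityMeasure_uniformTree {n : ℕ} (hn : 1 ≤ n) :
    MeasureTheory.IsProbabilityMeasure (uniformTree n) := by
  refine ProbabilityTheory.isProbabilityMeasure_uniformOn (finite_ofSize n)
    ⟨node (List.replicate (n - 1) (node [])), ?_⟩
  simp only [ofSize, Set.mem_ofPred_eq, numVertices, List.map_replicate, List.sum_replicate,
    List.map_nil, List.sum_nil, smul_eq_mul]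
  omega

end PlaneTree

/-!
Detaching the leftmost branch of the root shows that the generating functions `R k` of the
`k`-protected trees satisfy `R 0 = z + R 1` and `R (k + 1) = R k * (z + R (k + 1))`. In particular
`R 0 = z + R 0 ^ 2`, and induction on `k` gives
`(1 + z ^ (k - 2) * R 0 ^ 3) * R k = (1 - z) * z ^ (k - 2) * R 0 ^ 3`, as formal power series and as
numbers for `‖z‖ ≤ 1 / 4`, where `‖R 0‖ ≤ 1 / 2` singles out the principal branch of the square
root.

For the probabilities, expand `R k` into a geometric series in `z ^ (k - 2) * R 0 ^ 3`. The
coefficients of the powers of `R 0` count forests, and their ratios to the numbers of trees are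
explicit finite products of factors `1 + O(1 / n)`. Hence each term of the series has an expansion
up to order `1 / n` whose error is a polynomial in its parameters divided by `n ^ 2`, and the
geometric weights `8 ^ (-j) * 4 ^ (-j * (k - 2))` of the terms make the sum of these errors
`O(k ^ 4 / (4 ^ k * n ^ 2))`.
-/

/-! ### Power series -/

/-- The power series `φ`, evaluated at `z`, converges absolutely to `a`. -/
structure ConvergesAbsAt {A : Type*} [NormedCommRing A] (φ : PowerSeries A) (z a : A) : Prop where
  summable_norm : Summable fun n => ‖φ.coeff n * z ^ n‖
  hasSum : HasSum (fun n => φ.coeff n * z ^ n) a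

namespace ConvergesAbsAt

open PowerSeries Finset.HasAntidiagonal

variable {A : Type*} [NormedCommRing A] {φ ψ : A⟦X⟧} {z a b : A}

theorem X (z : A) : ConvergesAbsAt X z z := by
  have hzero (n : ℕ) (hn : n ≠ 1) : coeff n (PowerSeries.X : A⟦X⟧) * z ^ n = 0 := by
    rw [coeff_X, if_neg hn, zero_mul]
  constructor
  · exact summable_of_ne_finset_zero (s := {1}) fun n hn => by
      rw [hzero n (by simpa using hn), norm_zero]
  · simpa using hasSum_single 1 hzero

theorem add (hφ : ConvergesAbsAt φ z a) (hψ : ConvergesAbsAt ψ z b) :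
    ConvergesAbsAt (φ + ψ) z (a + b) := by
  constructor
  · refine (hφ.summable_norm.add hψ.summable_norm).of_nonneg_of_le (fun _ => norm_nonneg _)
      fun n => ?_
    rw [map_add, add_mul]
    exact norm_add_le _ _
  · simpa only [map_add, add_mul] using hφ.hasSum.add hψ.hasSum

theorem mul [CompleteSpace A] (hφ : ConvergesAbsAt φ z a) (hψ : ConvergesAbsAt ψ z b) :
    ConvergesAbsAt (φ * ψ) z (a * b) := by
  have hcoeff (n : ℕ) : coeff n (φ * ψ) * z ^ n =
      ∑ p ∈ antidiagonal n, coeff p.1 φ * z ^ p.1 * (coeff p.2 ψ * z ^ p.2) := by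
    rw [coeff_mul, Finset.sum_mul]
    refine Finset.sum_congr rfl fun p hp => ?_
    rw [← mem_antidiagonal.1 hp, pow_add]
    ring
  have hnorm : Summable fun n => ‖coeff n (φ * ψ) * z ^ n‖ := by
    simpa only [hcoeff] using
      summable_norm_sum_mul_antidiagonal_of_summable_norm hφ.summable_norm hψ.summable_norm
  refine ⟨hnorm, ?_⟩
  rw [hnorm.of_norm.hasSum_iff, ← hφ.hasSum.tsum_eq, ← hψ.hasSum.tsum_eq,
    tsum_mul_tsum_eq_tsum_sum_antidiagonal_of_summable_norm hφ.summable_norm hψ.summable_norm]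
  exact tsum_congr hcoeff

theorem unique (ha : ConvergesAbsAt φ z a) (hb : ConvergesAbsAt φ z b) : a = b :=
  ha.hasSum.unique hb.hasSum

end ConvergesAbsAt

section FixedPoint

open PowerSeries

variable {A : Type*} [CommRing A] {F : A⟦X⟧}

theorem coeff_succ_pow_succ_of_eq_X_add_sq (hF : F = X + F ^ 2) (n b : ℕ) :
    coeff (n + 1) (F ^ (b + 1)) = coeff n (F ^ b) + coeff (n + 1) (F ^ (b + 2)) := by
  rw [← coeff_succ_X_mul n (F ^ b), ← map_add]
  congr 1
  linear_combination F ^ b * hF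

-- With the Euler operator `θ = X d/dX`, the equation `F = X + F²` gives `(1 - 2F) θF = X = F - F²`,
-- that is `θF - F = 2F θF - F²`; the claim is this identity multiplied by `b (b + 1) F ^ (b - 1)`.
theorem coeff_pow_mul_of_eq_X_add_sq (hF : F = X + F ^ 2) (n b : ℕ) :
    coeff n (F ^ b) * ((b + 1) * (n - b)) = coeff n (F ^ (b + 1)) * (b * (2 * n - b - 1)) := by
  have hcoeff (G : A⟦X⟧) : coeff n (X * d⁄dX A G) = coeff n G * n := by
    cases n with
    | zero => simp
    | succ n => rw [coeff_succ_X_mul, coeff_derivative, Nat.cast_succ]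
  have hderiv : d⁄dX A F = 1 + 2 * F * d⁄dX A F := by
    have h := congrArg (d⁄dX A) hF
    rwa [map_add, derivative_X, derivative_pow, Nat.cast_ofNat, pow_one] at h
  have hpow : (b + 1) • (X * d⁄dX A (F ^ b) - b • F ^ b) =
      b • (2 • (X * d⁄dX A (F ^ (b + 1))) - (b + 1) • F ^ (b + 1)) := by
    cases b with
    | zero => simp
    | succ b =>
      simp only [derivative_pow, Nat.add_sub_cancel, nsmul_eq_mul]
      push_cast
      linear_combination ((b : A⟦X⟧) + 1) * (b + 2) * F ^ b * (X * hderiv - hF)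
  have h := congrArg (coeff n) hpow
  simp only [map_nsmul, map_sub, hcoeff] at h
  simp only [nsmul_eq_mul, Nat.cast_add, Nat.cast_one, Nat.cast_ofNat] at h
  linear_combination h

end FixedPoint

theorem eq_sum_range_add_of_one_add_mul_eq {R : Type*} [CommRing R] {w p c : R}
    (h : (1 + w) * p = c * w) (N : ℕ) :
    p = ∑ m ∈ Finset.range N, (-1) ^ m * (c * w ^ (m + 1)) + (-w) ^ N * p := by
  induction N with
  | zero => simp
  | succ N ih =>
    rw [Finset.sum_range_succ]
    have hneg : (-w) ^ N = (-1) ^ N * w ^ N := neg_pow w N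
    linear_combination ih + (-w) ^ N * h - c * w * hneg

/-! ### Estimates and sums of series -/

theorem sq_cpow_one_half_of_norm_one_sub_le {w : ℂ} (hw : ‖1 - w‖ ≤ 1) :
    (w ^ 2) ^ (1 / 2 : ℂ) = w := by
  have hnormSq : (1 - w.re) * (1 - w.re) + w.im * w.im ≤ 1 := by
    have h := Complex.normSq_eq_norm_sq (1 - w)
    simp only [Complex.normSq_apply, Complex.sub_re, Complex.sub_im, Complex.one_re,
      Complex.one_im, zero_sub, neg_mul_neg] at h
    rw [h]
    exact pow_le_one₀ (norm_nonneg _) hw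
  obtain hre | hre := lt_or_ge 0 w.re
  · rw [one_div, Complex.sq_cpow_two_inv hre]
  · have hzero : w = 0 := Complex.ext (show w.re = 0 by nlinarith) (show w.im = 0 by nlinarith)
    simp [hzero]

theorem norm_prod_one_add_sub_one_sub_sum_le {ι R : Type*} [NormedCommRing R] [NormOneClass R]
    (t : Finset ι) (f : ι → R) :
    ‖∏ i ∈ t, (1 + f i) - 1 - ∑ i ∈ t, f i‖ ≤
      Real.exp (∑ i ∈ t, ‖f i‖) - 1 - ∑ i ∈ t, ‖f i‖ := by
  classical
  induction t using Finset.induction_on with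
  | empty => simp
  | insert j t hj ih =>
    have hmul : ‖f j * (∏ i ∈ t, (1 + f i) - 1)‖ ≤
        ‖f j‖ * (Real.exp (∑ i ∈ t, ‖f i‖) - 1) :=
      (norm_mul_le _ _).trans (by gcongr; exact t.norm_prod_one_add_sub_one_le f)
    have hexp : (1 + ‖f j‖) * Real.exp (∑ i ∈ t, ‖f i‖) ≤
        Real.exp ‖f j‖ * Real.exp (∑ i ∈ t, ‖f i‖) := by
      gcongr
      linarith [Real.add_one_le_exp ‖f j‖]
    rw [Finset.prod_insert hj, Finset.sum_insert hj, Finset.sum_insert hj, Real.exp_add]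
    calc ‖(1 + f j) * ∏ i ∈ t, (1 + f i) - 1 - (f j + ∑ i ∈ t, f i)‖
        = ‖(∏ i ∈ t, (1 + f i) - 1 - ∑ i ∈ t, f i) + f j * (∏ i ∈ t, (1 + f i) - 1)‖ := by
          congr 1
          ring
      _ ≤ _ := norm_add_le_of_le ih hmul
      _ ≤ _ := by linarith

theorem norm_prod_one_add_sub_one_sub_sum_le_sq {ι R : Type*} [NormedCommRing R] [NormOneClass R]
    {t : Finset ι} {f : ι → R} (h : ∑ i ∈ t, ‖f i‖ ≤ 1) :
    ‖∏ i ∈ t, (1 + f i) - 1 - ∑ i ∈ t, f i‖ ≤ (∑ i ∈ t, ‖f i‖) ^ 2 := by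
  have hnonneg : 0 ≤ ∑ i ∈ t, ‖f i‖ := Finset.sum_nonneg fun i _ => norm_nonneg (f i)
  exact (norm_prod_one_add_sub_one_sub_sum_le t f).trans <| (le_abs_self _).trans <|
    Real.abs_exp_sub_one_sub_id_le (by rwa [abs_of_nonneg hnonneg])

theorem sum_range_natCast (n : ℕ) : ∑ j ∈ Finset.range n, (j : ℝ) = n * (n - 1) / 2 := by
  induction n with
  | zero => simp
  | succ n ih =>
    rw [Finset.sum_range_succ, ih]
    push_cast
    ring

theorem abs_div_sub_div_two_mul_le {c d n e : ℝ} (hn : 0 < n) (hd : n ≤ d)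
    (he : |2 * n - d| ≤ 2 * e) : |c / d - c / (2 * n)| ≤ |c| * e / n ^ 2 := by
  have hd0 : 0 < d := hn.trans_le hd
  have heq : c / d - c / (2 * n) = c * (2 * n - d) / (2 * (n * d)) := by
    field_simp
  rw [heq, abs_div, abs_mul, abs_of_pos (show 0 < 2 * (n * d) by positivity)]
  have he0 : 0 ≤ 2 * e := (abs_nonneg _).trans he
  calc |c| * |2 * n - d| / (2 * (n * d)) ≤ |c| * (2 * e) / (2 * (n * n)) := by gcongr
    _ = |c| * e / n ^ 2 := by
      field_simp

theorem abs_prod_one_add_div_sub_le {ι : Type*} {t : Finset ι} {c d : ι → ℝ} {n L : ℝ}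
    (hL : 1 ≤ L) (hLn : L ^ 2 ≤ n) (hc : ∑ i ∈ t, |c i| ≤ L ^ 2) (hd : ∀ i ∈ t, n ≤ d i)
    (hd' : ∀ i ∈ t, |2 * n - d i| ≤ 2 * L) :
    |∏ i ∈ t, (1 + c i / d i) - (1 + (∑ i ∈ t, c i) / (2 * n))| ≤ 2 * (L ^ 4 / n ^ 2) := by
  have hn : 0 < n := by nlinarith
  have hsum : ∑ i ∈ t, ‖c i / d i‖ ≤ L ^ 2 / n := by
    calc ∑ i ∈ t, ‖c i / d i‖ ≤ ∑ i ∈ t, |c i| / n := by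
          refine Finset.sum_le_sum fun i hi => ?_
          rw [Real.norm_eq_abs, abs_div, abs_of_pos (hn.trans_le (hd i hi))]
          gcongr
          exact hd i hi
      _ = (∑ i ∈ t, |c i|) / n := (Finset.sum_div _ _ _).symm
      _ ≤ L ^ 2 / n := by gcongr
  have hprod : |∏ i ∈ t, (1 + c i / d i) - 1 - ∑ i ∈ t, c i / d i| ≤ L ^ 4 / n ^ 2 := by
    refine (norm_prod_one_add_sub_one_sub_sum_le_sq
      (hsum.trans (div_le_one_of_le₀ hLn hn.le))).trans ?_
    calc (∑ i ∈ t, ‖c i / d i‖) ^ 2 ≤ (L ^ 2 / n) ^ 2 :=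
          pow_le_pow_left₀ (Finset.sum_nonneg fun i _ => norm_nonneg _) hsum 2
      _ = L ^ 4 / n ^ 2 := by ring
  have hlinear : |∑ i ∈ t, c i / d i - (∑ i ∈ t, c i) / (2 * n)| ≤ L ^ 4 / n ^ 2 := by
    rw [Finset.sum_div, ← Finset.sum_sub_distrib]
    calc |∑ i ∈ t, (c i / d i - c i / (2 * n))|
        ≤ ∑ i ∈ t, |c i / d i - c i / (2 * n)| := Finset.abs_sum_le_sum_abs _ _
      _ ≤ ∑ i ∈ t, |c i| * L / n ^ 2 := Finset.sum_le_sum fun i hi =>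
          abs_div_sub_div_two_mul_le hn (hd i hi) (hd' i hi)
      _ = (∑ i ∈ t, |c i|) * L / n ^ 2 := by rw [← Finset.sum_div, ← Finset.sum_mul]
      _ ≤ L ^ 2 * L ^ 2 / n ^ 2 := by
        gcongr
        nlinarith
      _ = L ^ 4 / n ^ 2 := by ring
  have htri := abs_add_le (∏ i ∈ t, (1 + c i / d i) - 1 - ∑ i ∈ t, c i / d i)
    (∑ i ∈ t, c i / d i - (∑ i ∈ t, c i) / (2 * n))
  rw [show ∏ i ∈ t, (1 + c i / d i) - (1 + (∑ i ∈ t, c i) / (2 * n)) =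
    (∏ i ∈ t, (1 + c i / d i) - 1 - ∑ i ∈ t, c i / d i) +
      (∑ i ∈ t, c i / d i - (∑ i ∈ t, c i) / (2 * n)) by ring]
  linarith

theorem abs_prod_mul_prod_sub_le {m : ℝ} {s b : ℕ} (h : 2 * ((s : ℝ) + b + 1) ^ 2 ≤ m + s) :
    |(∏ i ∈ Finset.range s, (1 + 3 / (2 * (m + i) - 1))) *
        ∏ j ∈ Finset.range b, (1 - (j : ℝ) / (2 * m - j - 2)) -
      (1 + (3 * s - (b : ℝ) * (b - 1) / 2) / (2 * (m + s)))| ≤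
      2 * (((s : ℝ) + b + 1) ^ 4 / (m + s) ^ 2) := by
  have hs : (0 : ℝ) ≤ s := s.cast_nonneg
  have hb : (0 : ℝ) ≤ b := b.cast_nonneg
  have hlinear : 2 * (s : ℝ) + 2 * b + 2 ≤ m + s := by nlinarith
  let c : ℕ ⊕ ℕ → ℝ := Sum.elim (fun _ => 3) fun j => -j
  let d : ℕ ⊕ ℕ → ℝ := Sum.elim (fun i => 2 * (m + i) - 1) fun j => 2 * m - j - 2
  let t := (Finset.range s).disjSum (Finset.range b)
  have hdenom (i : ℕ ⊕ ℕ) (hi : i ∈ t) :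
      m + s ≤ d i ∧ |2 * (m + s) - d i| ≤ 2 * ((s : ℝ) + b + 1) := by
    rw [abs_le]
    obtain i | j := i
    · have hi' : (i : ℝ) + 1 ≤ s := by
        exact_mod_cast Finset.mem_range.1 (Finset.inl_mem_disjSum.1 hi)
      have := i.cast_nonneg (α := ℝ)
      simp only [d, Sum.elim_inl]
      refine ⟨?_, ?_, ?_⟩ <;> linarith
    · have hj' : (j : ℝ) + 1 ≤ b := by
        exact_mod_cast Finset.mem_range.1 (Finset.inr_mem_disjSum.1 hi)
      have := j.cast_nonneg (α := ℝ)
      simp only [d, Sum.elim_inr]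
      refine ⟨?_, ?_, ?_⟩ <;> linarith
  have hc : ∑ i ∈ t, |c i| ≤ ((s : ℝ) + b + 1) ^ 2 := by
    simp only [t, c, Finset.sum_disjSum, Sum.elim_inl, Sum.elim_inr, abs_neg, Nat.abs_cast,
      Nat.abs_ofNat, Finset.sum_const, Finset.card_range, nsmul_eq_mul, sum_range_natCast]
    nlinarith [mul_nonneg hs hb, sq_nonneg ((s : ℝ) - 1)]
  have key := abs_prod_one_add_div_sub_le (n := m + s) (L := s + b + 1) (by linarith)
    (by nlinarith) hc (fun i hi => (hdenom i hi).1) fun i hi => (hdenom i hi).2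
  simpa only [t, c, d, Finset.sum_disjSum, Finset.prod_disjSum, Sum.elim_inl, Sum.elim_inr,
    Finset.sum_const, Finset.card_range, nsmul_eq_mul, Finset.sum_neg_distrib,
    sum_range_natCast, neg_div, ← sub_eq_add_neg, mul_comm (s : ℝ)] using key

section Geometric

variable {𝕜 : Type*} [NormedField 𝕜] {u : 𝕜}

theorem hasSum_ascFactorial_mul_geometric_of_norm_lt_one (k : ℕ) (hu : ‖u‖ < 1) :
    HasSum (fun m : ℕ => ((m + 1).ascFactorial k : 𝕜) * u ^ m)
      (k.factorial / (1 - u) ^ (k + 1)) := by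
  simpa only [Nat.ascFactorial_eq_factorial_mul_choose, Nat.cast_mul, mul_assoc, mul_one_div]
    using (hasSum_choose_mul_geometric_of_norm_lt_one k hu).mul_left (k.factorial : 𝕜)

theorem hasSum_add_one_mul_geometric_of_norm_lt_one (hu : ‖u‖ < 1) :
    HasSum (fun m : ℕ => (m + 1 : 𝕜) * u ^ m) (1 / (1 - u) ^ 2) := by
  simpa using hasSum_choose_mul_geometric_of_norm_lt_one 1 hu

theorem hasSum_add_one_sq_mul_geometric_of_norm_lt_one (hu : ‖u‖ < 1) :
    HasSum (fun m : ℕ => (m + 1 : 𝕜) ^ 2 * u ^ m) ((1 + u) / (1 - u) ^ 3) := by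
  have hu' : 1 - u ≠ 0 := sub_ne_zero.2 fun h => by simp [← h] at hu
  convert! (hasSum_ascFactorial_mul_geometric_of_norm_lt_one 2 hu).sub
    (hasSum_add_one_mul_geometric_of_norm_lt_one hu) using 1
  · ext m
    simp only [Nat.ascFactorial]
    push_cast
    ring
  · rw [Nat.factorial_two]
    push_cast
    field_simp
    ring

theorem hasSum_add_one_pow_three_mul_geometric_of_norm_lt_one (hu : ‖u‖ < 1) :
    HasSum (fun m : ℕ => (m + 1 : 𝕜) ^ 3 * u ^ m) ((1 + 4 * u + u ^ 2) / (1 - u) ^ 4) := by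
  have hu' : 1 - u ≠ 0 := sub_ne_zero.2 fun h => by simp [← h] at hu
  convert! ((hasSum_ascFactorial_mul_geometric_of_norm_lt_one 3 hu).sub
    ((hasSum_add_one_sq_mul_geometric_of_norm_lt_one hu).mul_left 3)).sub
    ((hasSum_add_one_mul_geometric_of_norm_lt_one hu).mul_left 2) using 1
  · ext m
    simp only [Nat.ascFactorial]
    push_cast
    ring
  · rw [show Nat.factorial 3 = 6 from rfl]
    push_cast
    field_simp
    ring

end Geometric

theorem exists_pow_four_div_four_pow_mul_sq_le :
    ∃ D : ℝ, ∀ n : ℕ, 1 ≤ n → ∀ k : ℕ,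
      (k : ℝ) ^ 4 / (4 ^ k * n ^ 2) ≤ D * ((k : ℝ) ^ 2 / (3 ^ k * (n : ℝ) ^ (3 / 2 : ℝ))) := by
  obtain ⟨D, hD⟩ := (tendsto_pow_const_mul_const_pow_of_abs_lt_one 2
    (show |(3 / 4 : ℝ)| < 1 by norm_num [abs_lt])).bddAbove_range
  refine ⟨D, fun n hn k => ?_⟩
  have hn' : (1 : ℝ) ≤ n := by exact_mod_cast hn
  have hrpow : (n : ℝ) ^ (3 / 2 : ℝ) ≤ n ^ 2 := by
    rw [← Real.rpow_two]
    exact Real.rpow_le_rpow_of_exponent_le hn' (by norm_num)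
  have : 0 < (n : ℝ) ^ (3 / 2 : ℝ) := by positivity
  calc (k : ℝ) ^ 4 / (4 ^ k * n ^ 2) ≤ (k : ℝ) ^ 4 / (4 ^ k * (n : ℝ) ^ (3 / 2 : ℝ)) := by gcongr
    _ = (k : ℝ) ^ 2 * (3 / 4) ^ k * ((k : ℝ) ^ 2 / (3 ^ k * (n : ℝ) ^ (3 / 2 : ℝ))) := by
      rw [div_pow]
      field_simp
    _ ≤ D * ((k : ℝ) ^ 2 / (3 ^ k * (n : ℝ) ^ (3 / 2 : ℝ))) := by
      gcongr
      exact hD (Set.mem_range_self k)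

theorem uniformOn_real_eq_ncard_div {Ω : Type*} [MeasurableSpace Ω] [MeasurableSingletonClass Ω]
    {s : Set Ω} (hs : s.Finite) (t : Set Ω) :
    (ProbabilityTheory.uniformOn s).real t = (s ∩ t).ncard / s.ncard := by
  have hcount {u : Set Ω} (hu : u.Finite) : MeasureTheory.Measure.count.real u = u.ncard := by
    rw [MeasureTheory.measureReal_def, MeasureTheory.Measure.count_apply_finite u hu,
      Set.ncard_eq_toFinset_card u hu, ENNReal.toReal_natCast]
  rw [ProbabilityTheory.uniformOn, MeasureTheory.measureReal_def,
    ProbabilityTheory.cond_apply hs.measurableSet, ENNReal.toReal_mul, ENNReal.toReal_inv,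
    ← MeasureTheory.measureReal_def, ← MeasureTheory.measureReal_def, hcount hs,
    hcount (hs.inter_of_left t), inv_mul_eq_div]

namespace PlaneTree

open PowerSeries Finset.HasAntidiagonal

/-! ### Protected trees -/

/-- The tree obtained from the second argument by attaching the first one as a new leftmost branch
of the root. Every tree with at least two vertices arises in this way exactly once. -/
def cons (t : PlaneTree) : PlaneTree → PlaneTree
  | node ts => node (t :: ts)

theorem cons_injective2 : Function.Injective2 cons := by
  rintro t t' ⟨ts⟩ ⟨ts'⟩ h
  simp only [cons, node.injEq, List.cons.injEq] at h
  exact ⟨h.1, congrArg node h.2⟩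

theorem eq_node_nil_or_exists_eq_cons (t : PlaneTree) : t = node [] ∨ ∃ u v, t = cons u v := by
  rcases t with ⟨_ | ⟨u, us⟩⟩
  · exact Or.inl rfl
  · exact Or.inr ⟨u, node us, rfl⟩

theorem numVertices_node_nil : (node []).numVertices = 1 := by
  simp [numVertices]

theorem numVertices_cons (t u : PlaneTree) :
    (cons t u).numVertices = t.numVertices + u.numVertices := by
  rcases u with ⟨us⟩
  simp only [cons, numVertices, List.map_cons, List.sum_cons]
  ring

theorem isProtected_zero (t : PlaneTree) : t.IsProtected 0 := fun _ _ => Nat.zero_le _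

theorem isProtected_succ_node {k : ℕ} {ts : List PlaneTree} :
    (node ts).IsProtected (k + 1) ↔ ts ≠ [] ∧ ∀ t ∈ ts, t.IsProtected k := by
  constructor
  · intro h
    refine ⟨?_, fun t ht d hd => Nat.le_of_succ_le_succ (h _ (.branch ht hd))⟩
    rintro rfl
    exact Nat.not_succ_le_zero k (h 0 .leaf)
  · rintro ⟨hne, h⟩ d hd
    cases hd with
    | leaf => exact absurd rfl hne
    | branch ht hd => exact Nat.succ_le_succ (h _ ht _ hd)

theorem not_isProtected_succ_node_nil (k : ℕ) : ¬ (node []).IsProtected (k + 1) := fun h =>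
  (isProtected_succ_node.1 h).1 rfl

theorem isProtected_succ_cons {k : ℕ} {t u : PlaneTree} :
    (cons t u).IsProtected (k + 1) ↔
      t.IsProtected k ∧ (u = node [] ∨ u.IsProtected (k + 1)) := by
  rcases u with ⟨_ | ⟨u, us⟩⟩ <;> simp [cons, isProtected_succ_node]

theorem setOf_isProtected_zero :
    {t : PlaneTree | t.IsProtected 0} = insert (node []) {t | t.IsProtected 1} := by
  ext t
  simp only [Set.mem_ofPred_eq, isProtected_zero, Set.mem_insert_iff, true_iff]
  rcases t with ⟨_ | ⟨u, us⟩⟩ <;> simp [isProtected_succ_node, isProtected_zero]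

theorem setOf_isProtected_succ (k : ℕ) :
    {t : PlaneTree | t.IsProtected (k + 1)} =
      Set.image2 cons {t | t.IsProtected k} (insert (node []) {t | t.IsProtected (k + 1)}) := by
  ext t
  constructor
  · intro ht
    obtain rfl | ⟨u, v, rfl⟩ := eq_node_nil_or_exists_eq_cons t
    · exact absurd ht (not_isProtected_succ_node_nil k)
    · obtain ⟨hu, hv⟩ := isProtected_succ_cons.1 ht
      exact Set.mem_image2_of_mem hu hv
  · rintro ⟨u, hu, v, hv, rfl⟩
    exact isProtected_succ_cons.2 ⟨hu, hv⟩

theorem ofSize_zero : ofSize 0 = ∅ := by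
  refine Set.eq_empty_of_forall_notMem ?_
  rintro ⟨ts⟩ (h : numVertices _ = 0)
  simp [numVertices] at h

theorem finite_ofSize_inter (n : ℕ) (S : Set PlaneTree) : (ofSize n ∩ S).Finite :=
  (finite_ofSize n).inter_of_left S

theorem ofSize_inter_image2_cons (n : ℕ) (S T : Set PlaneTree) :
    ofSize n ∩ Set.image2 cons S T =
      ⋃ p ∈ antidiagonal n, Set.image2 cons (ofSize p.1 ∩ S) (ofSize p.2 ∩ T) := by
  ext t
  simp only [Set.mem_iUnion, Set.mem_inter_iff, mem_antidiagonal, exists_prop]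
  constructor
  · rintro ⟨ht, u, hu, v, hv, rfl⟩
    exact ⟨(_, _), (numVertices_cons u v).symm.trans ht, u, ⟨rfl, hu⟩, v, ⟨rfl, hv⟩, rfl⟩
  · rintro ⟨⟨i, j⟩, hij, u, ⟨rfl, hu⟩, v, ⟨rfl, hv⟩, rfl⟩
    exact ⟨(numVertices_cons u v).trans hij, u, hu, v, hv, rfl⟩

theorem ncard_image2_cons (S T : Set PlaneTree) :
    (Set.image2 cons S T).ncard = S.ncard * T.ncard := by
  rw [← Set.image_uncurry_prod, Set.ncard_image_of_injective _ cons_injective2.uncurry,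
    Set.ncard_prod]

theorem ncard_ofSize_inter_image2_cons (n : ℕ) (S T : Set PlaneTree) :
    (ofSize n ∩ Set.image2 cons S T).ncard =
      ∑ p ∈ antidiagonal n, (ofSize p.1 ∩ S).ncard * (ofSize p.2 ∩ T).ncard := by
  have hdisj : (antidiagonal n : Set (ℕ × ℕ)).PairwiseDisjoint fun p =>
      Set.image2 cons (ofSize p.1 ∩ S) (ofSize p.2 ∩ T) := by
    refine fun p _ q _ hpq => Set.disjoint_left.2 ?_
    rintro _ ⟨u, ⟨hu, -⟩, v, ⟨hv, -⟩, rfl⟩ ⟨u', ⟨hu', -⟩, v', ⟨hv', -⟩, h⟩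
    obtain ⟨rfl, rfl⟩ := cons_injective2 h
    exact hpq (Prod.ext (hu.symm.trans hu') (hv.symm.trans hv'))
  have hunion := (antidiagonal n).finite_toSet.ncard_biUnion
    (fun p _ => (finite_ofSize_inter p.1 S).image2 cons (finite_ofSize_inter p.2 T)) hdisj
  simp only [finsum_mem_coe_finset, ncard_image2_cons] at hunion
  exact (congrArg Set.ncard (ofSize_inter_image2_cons n S T)).trans hunion

section CountSeries

variable (A : Type*) [CommSemiring A]

/-- The generating function, by number of vertices, of a set of plane trees. -/
noncomputable def countSeries (S : Set PlaneTree) : A⟦X⟧ :=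
  mk fun n => ((ofSize n ∩ S).ncard : A)

theorem countSeries_image2_cons (S T : Set PlaneTree) :
    countSeries A (Set.image2 cons S T) = countSeries A S * countSeries A T := by
  ext n
  simp only [countSeries, coeff_mul, coeff_mk, ncard_ofSize_inter_image2_cons, Nat.cast_sum,
    Nat.cast_mul]

theorem countSeries_insert_node_nil {S : Set PlaneTree} (h : node [] ∉ S) :
    countSeries A (insert (node []) S) = X + countSeries A S := by
  ext n
  simp only [countSeries, map_add, coeff_X, coeff_mk]
  split_ifs with hn
  · subst hn
    rw [Set.inter_insert_of_mem (show node [] ∈ ofSize 1 from numVertices_node_nil),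
      Set.ncard_insert_of_notMem (fun h' => h h'.2) (finite_ofSize_inter _ _), add_comm,
      Nat.cast_add, Nat.cast_one]
  · have hnotMem : node [] ∉ ofSize n := fun h' => hn (h'.symm.trans numVertices_node_nil)
    rw [Set.inter_insert_of_notMem hnotMem, zero_add]

/-- The generating function of the `k`-protected plane trees, the paper's `R_{≥k}`. -/
noncomputable def protectedSeries (k : ℕ) : A⟦X⟧ := countSeries A {t | t.IsProtected k}

theorem coeff_protectedSeries (n k : ℕ) : coeff n (protectedSeries A k) = numProtected n k := by
  simp only [protectedSeries, countSeries, coeff_mk]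
  rfl

theorem protectedSeries_zero_eq : protectedSeries A 0 = X + protectedSeries A 1 := by
  rw [protectedSeries, setOf_isProtected_zero,
    countSeries_insert_node_nil A (not_isProtected_succ_node_nil 0), protectedSeries]

theorem protectedSeries_succ_eq (k : ℕ) :
    protectedSeries A (k + 1) = protectedSeries A k * (X + protectedSeries A (k + 1)) := by
  conv_lhs => rw [protectedSeries, setOf_isProtected_succ, countSeries_image2_cons,
    countSeries_insert_node_nil A (not_isProtected_succ_node_nil k)]
  rfl

theorem X_dvd_protectedSeries (k : ℕ) : X ∣ protectedSeries A k := by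
  rw [X_dvd_iff, ← coeff_zero_eq_constantCoeff_apply, coeff_protectedSeries, numProtected,
    ofSize_zero]
  simp

end CountSeries

/-- The system of equations satisfied by the generating functions `P k` of the `k`-protected plane
trees, both as formal power series with `z = X` and as numbers at a point `z`: a tree is a single
vertex or `1`-protected, and a `(k + 1)`-protected tree is a `k`-protected branch attached to a tree
which is a single vertex or `(k + 1)`-protected. -/
structure IsProtectionSequence {A : Type*} [CommRing A] (z : A) (P : ℕ → A) : Prop where
  zero_eq : P 0 = z + P 1
  succ_eq (k : ℕ) : P (k + 1) = P k * (z + P (k + 1))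

theorem isProtectionSequence_protectedSeries (A : Type*) [CommRing A] :
    IsProtectionSequence (X : A⟦X⟧) (protectedSeries A) :=
  ⟨protectedSeries_zero_eq A, protectedSeries_succ_eq A⟩

namespace IsProtectionSequence

variable {A : Type*} [CommRing A] {z : A} {P : ℕ → A}

theorem one_eq_sq (h : IsProtectionSequence z P) : P 1 = P 0 ^ 2 := by
  rw [h.succ_eq 0, zero_add, ← h.zero_eq, sq]

theorem zero_eq_add_sq (h : IsProtectionSequence z P) : P 0 = z + P 0 ^ 2 := by
  rw [← h.one_eq_sq, ← h.zero_eq]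

theorem add_pow_mul_cube_mul_succ (h : IsProtectionSequence z P) (k : ℕ) :
    (z + z ^ k * P 0 ^ 3) * P (k + 1) = (1 - z) * (z ^ k * P 0 ^ 3) := by
  induction k with
  | zero =>
    have hcube : z + P 0 ^ 3 = (1 - z) * P 0 := by
      linear_combination (-1 - P 0) * h.zero_eq_add_sq
    rw [pow_zero, one_mul, hcube, zero_add, h.one_eq_sq]
    ring
  | succ k ih =>
    linear_combination (z + z ^ k * P 0 ^ 3) * h.succ_eq (k + 1) + (z + P (k + 2)) * ih

end IsProtectionSequence

theorem one_add_X_pow_mul_cube_mul_protectedSeries (A : Type*) [CommRing A] (k : ℕ) :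
    (1 + X ^ k * protectedSeries A 0 ^ 3) * protectedSeries A (k + 2) =
      (1 - X) * (X ^ k * protectedSeries A 0 ^ 3) := by
  refine X_mul_cancel ?_
  linear_combination
    (isProtectionSequence_protectedSeries A).add_pow_mul_cube_mul_succ (k + 1)

/-! ### Forests -/

/-- The number of ordered forests of `b` plane trees with `n` vertices in total, as a real
number. -/
noncomputable def forestCount (n b : ℕ) : ℝ := coeff n (protectedSeries ℝ 0 ^ b)

theorem protectedSeries_zero_eq_X_add_sq (A : Type*) [CommRing A] :
    protectedSeries A 0 = X + protectedSeries A 0 ^ 2 :=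
  (isProtectionSequence_protectedSeries A).zero_eq_add_sq

theorem forestCount_one (n : ℕ) : forestCount n 1 = numProtected n 0 := by
  rw [forestCount, pow_one, coeff_protectedSeries]

theorem forestCount_eq_zero_of_lt {n b : ℕ} (h : n < b) : forestCount n b = 0 :=
  X_pow_dvd_iff.1 (pow_dvd_pow_of_dvd (X_dvd_protectedSeries ℝ 0) b) n h

theorem forestCount_mul (n b : ℕ) :
    forestCount n b * ((b + 1) * (n - b)) = forestCount n (b + 1) * (b * (2 * n - b - 1)) :=
  coeff_pow_mul_of_eq_X_add_sq (protectedSeries_zero_eq_X_add_sq ℝ) n b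

theorem forestCount_succ_succ (n b : ℕ) :
    forestCount (n + 1) (b + 1) = forestCount n b + forestCount (n + 1) (b + 2) :=
  coeff_succ_pow_succ_of_eq_X_add_sq (protectedSeries_zero_eq_X_add_sq ℝ) n b

theorem forestCount_succ_one_mul {n : ℕ} (hn : 1 ≤ n) :
    forestCount (n + 1) 1 * (n + 1) = forestCount n 1 * (4 * n - 2) := by
  have hzero : forestCount n 0 = 0 := by
    rw [forestCount, pow_zero, coeff_one, if_neg (by lia)]
  have hone : forestCount (n + 1) 1 = forestCount n 0 + forestCount (n + 1) 2 :=
    forestCount_succ_succ n 0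
  have htwo : forestCount (n + 1) 2 = forestCount n 1 + forestCount (n + 1) 3 :=
    forestCount_succ_succ n 1
  have hmul : forestCount (n + 1) 2 * ((2 + 1) * ((n + 1 : ℝ) - 2)) =
      forestCount (n + 1) 3 * (2 * (2 * (n + 1 : ℝ) - 2 - 1)) := by
    exact_mod_cast forestCount_mul (n + 1) 2
  linear_combination -hmul + (n + 1) * hone + (4 * n - 2) * htwo + (n + 1) * hzero

theorem forestCount_one_one : forestCount 1 1 = 1 := by
  have htwo : forestCount 1 2 = 0 := forestCount_eq_zero_of_lt Nat.one_lt_two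
  rw [forestCount_succ_succ 0 0, htwo, add_zero, forestCount, pow_zero, coeff_zero_one]

theorem forestCount_one_pos {n : ℕ} (hn : 1 ≤ n) : 0 < forestCount n 1 := by
  induction n, hn using Nat.le_induction with
  | base => exact forestCount_one_one ▸ one_pos
  | succ n hn ih =>
    have hn' : (1 : ℝ) ≤ n := by exact_mod_cast hn
    have hprod : 0 < forestCount (n + 1) 1 * (n + 1) := by
      rw [forestCount_succ_one_mul hn]
      exact mul_pos ih (by linarith)
    exact pos_of_mul_pos_left hprod (by positivity)

theorem sum_range_forestCount_one_mul_pow (N : ℕ) :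
    ∑ n ∈ Finset.range (N + 1), forestCount n 1 * (1 / 4) ^ n =
      1 / 2 - 2 * (N + 1) * forestCount (N + 1) 1 * (1 / 4) ^ (N + 1) := by
  induction N with
  | zero => norm_num [forestCount_eq_zero_of_lt, forestCount_one_one]
  | succ N ih =>
    have hrec := forestCount_succ_one_mul (Nat.le_add_left 1 N)
    rw [Finset.sum_range_succ, ih]
    push_cast at hrec ⊢
    rw [pow_succ _ (N + 1)]
    linear_combination (1 / 2) * (1 / 4) ^ (N + 1) * hrec

theorem sum_range_numProtected_zero_mul_pow_le (N : ℕ) :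
    ∑ n ∈ Finset.range N, (numProtected n 0 : ℝ) * (1 / 4) ^ n ≤ 1 / 2 := by
  simp only [← forestCount_one]
  cases N with
  | zero => norm_num
  | succ N =>
    have hpos : 0 < forestCount (N + 1) 1 := forestCount_one_pos N.succ_pos
    rw [sum_range_forestCount_one_mul_pow, sub_le_self_iff]
    positivity

theorem summable_numProtected_zero_mul_pow :
    Summable fun n => (numProtected n 0 : ℝ) * (1 / 4) ^ n :=
  summable_of_sum_range_le (fun _ => by positivity) sum_range_numProtected_zero_mul_pow_le

/-! ### Values of the generating functions -/

/-- The value at `z` of the generating function of the `k`-protected plane trees. -/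
noncomputable def protectedGF (z : ℂ) (k : ℕ) : ℂ := ∑' n : ℕ, (numProtected n k : ℂ) * z ^ n

theorem numProtected_le_numProtected_zero (n k : ℕ) : numProtected n k ≤ numProtected n 0 :=
  Set.ncard_le_ncard (fun _ h => ⟨h.1, isProtected_zero _⟩) ((finite_ofSize n).sep _)

section ClosedDisc

variable {z : ℂ} (hz : ‖z‖ ≤ 1 / 4)

include hz

theorem norm_numProtected_mul_pow_le (n k : ℕ) :
    ‖(numProtected n k : ℂ) * z ^ n‖ ≤ numProtected n 0 * (1 / 4) ^ n := by
  rw [norm_mul, norm_pow, Complex.norm_natCast]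
  have h : (numProtected n k : ℝ) ≤ numProtected n 0 :=
    Nat.cast_le.2 (numProtected_le_numProtected_zero n k)
  gcongr

theorem convergesAbsAt_protectedGF (k : ℕ) :
    ConvergesAbsAt (protectedSeries ℂ k) z (protectedGF z k) := by
  have hnorm : Summable fun n => ‖(numProtected n k : ℂ) * z ^ n‖ :=
    summable_numProtected_zero_mul_pow.of_nonneg_of_le (fun _ => norm_nonneg _)
      fun n => norm_numProtected_mul_pow_le hz n k
  constructor <;> simp only [coeff_protectedSeries]
  exacts [hnorm, hnorm.of_norm.hasSum]

theorem norm_protectedGF_le (k : ℕ) : ‖protectedGF z k‖ ≤ 1 / 2 :=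
  (tsum_of_norm_bounded summable_numProtected_zero_mul_pow.hasSum
    fun n => norm_numProtected_mul_pow_le hz n k).trans <|
    Real.tsum_le_of_sum_range_le (fun _ => by positivity) sum_range_numProtected_zero_mul_pow_le

theorem isProtectionSequence_protectedGF : IsProtectionSequence z (protectedGF z) := by
  have hX := ConvergesAbsAt.X z
  have hP := convergesAbsAt_protectedGF hz
  refine ⟨(hP 0).unique ?_, fun k => (hP (k + 1)).unique ?_⟩
  · simpa only [← protectedSeries_zero_eq] using hX.add (hP 1)
  · simpa only [← protectedSeries_succ_eq] using (hP k).mul (hX.add (hP (k + 1)))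

theorem protectedGF_zero_eq : protectedGF z 0 = (1 - (1 - 4 * z) ^ (1 / 2 : ℂ)) / 2 := by
  set R := protectedGF z 0
  have hsq : 1 - 4 * z = (1 - 2 * R) ^ 2 := by
    linear_combination 4 * (isProtectionSequence_protectedGF hz).zero_eq_add_sq
  have hnorm : ‖1 - (1 - 2 * R)‖ ≤ 1 := by
    rw [sub_sub_cancel, norm_mul, Complex.norm_ofNat]
    linarith [norm_protectedGF_le hz 0]
  rw [hsq, sq_cpow_one_half_of_norm_one_sub_le hnorm]
  ring

theorem hasSum_protectedGF (k : ℕ) :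
    HasSum (fun n : ℕ => (numProtected n k : ℂ) * z ^ n) (protectedGF z k) := by
  simpa only [coeff_protectedSeries] using (convergesAbsAt_protectedGF hz k).hasSum

end ClosedDisc

theorem IsProtectionSequence.add_pow_mul_cube_ne_zero {K : Type*} [Field K] {z : K} {P : ℕ → K}
    (h : IsProtectionSequence z P) (hz : z ≠ 0) (hz' : z ≠ 1) (k : ℕ) :
    z + z ^ k * P 0 ^ 3 ≠ 0 := by
  intro hzero
  have hmul := h.add_pow_mul_cube_mul_succ k
  rw [hzero, zero_mul, eq_neg_of_add_eq_zero_right hzero] at hmul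
  exact (mul_ne_zero (sub_ne_zero.2 hz'.symm) (neg_ne_zero.2 hz)) hmul.symm

theorem IsProtectionSequence.one_add_zpow_mul_cube_ne_zero_and_eq {K : Type*} [Field K] {z : K}
    {P : ℕ → K} (h : IsProtectionSequence z P) (hz : z ≠ 0) (hz' : z ≠ 1) {k : ℕ} (hk : 1 ≤ k) :
    1 + z ^ ((k : ℤ) - 2) * P 0 ^ 3 ≠ 0 ∧
      P k = (1 - z) * z ^ ((k : ℤ) - 2) * P 0 ^ 3 / (1 + z ^ ((k : ℤ) - 2) * P 0 ^ 3) := by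
  obtain ⟨j, rfl⟩ := Nat.exists_eq_add_of_le' hk
  have hzpow : z * z ^ (((j + 1 : ℕ) : ℤ) - 2) = z ^ j := by
    rw [← zpow_one_add₀ hz, ← zpow_natCast]
    congr 1
    push_cast
    ring
  have hmul : z * (1 + z ^ (((j + 1 : ℕ) : ℤ) - 2) * P 0 ^ 3) = z + z ^ j * P 0 ^ 3 := by
    rw [← hzpow]
    ring
  have hne : 1 + z ^ (((j + 1 : ℕ) : ℤ) - 2) * P 0 ^ 3 ≠ 0 :=
    right_ne_zero_of_mul (hmul ▸ h.add_pow_mul_cube_ne_zero hz hz' j)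
  refine ⟨hne, (eq_div_iff hne).2 (mul_left_cancel₀ hz ?_)⟩
  linear_combination h.add_pow_mul_cube_mul_succ j + P (j + 1) * hmul +
    (P 0 ^ 3) * (z - 1) * hzpow

/-! ### Asymptotic ratios of forest counts -/

theorem four_pow_mul_forestCount_one {m : ℕ} (hm : 1 ≤ m) (s : ℕ) :
    4 ^ s * forestCount m 1 =
      forestCount (m + s) 1 * ∏ i ∈ Finset.range s, (1 + 3 / (2 * ((m : ℝ) + i) - 1)) := by
  have hm' : (1 : ℝ) ≤ m := by exact_mod_cast hm
  induction s with
  | zero => simp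
  | succ s ih =>
    have hrec : 4 * forestCount (m + s) 1 =
        forestCount (m + (s + 1)) 1 * (1 + 3 / (2 * ((m : ℝ) + s) - 1)) := by
      have h := forestCount_succ_one_mul (hm.trans (Nat.le_add_right m s))
      have hden : 2 * ((m : ℝ) + s) - 1 ≠ 0 := by
        have : (0 : ℝ) ≤ s := s.cast_nonneg
        linarith
      push_cast at h
      rw [← add_assoc m s 1]
      field_simp
      linear_combination -2 * h
    rw [pow_succ, Finset.prod_range_succ]
    linear_combination 4 * ih +
      (∏ i ∈ Finset.range s, (1 + 3 / (2 * ((m : ℝ) + i) - 1))) * hrec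

theorem two_pow_mul_forestCount {m b : ℕ} (hb : b < m) :
    2 ^ b * forestCount m (b + 1) =
      (b + 1) * forestCount m 1 *
        ∏ j ∈ Finset.range b, (1 - (j : ℝ) / (2 * m - j - 2)) := by
  induction b with
  | zero => simp
  | succ b ih =>
    have hrec : 2 * (b + 1) * forestCount m (b + 2) =
        (b + 2) * forestCount m (b + 1) * (1 - (b : ℝ) / (2 * m - b - 2)) := by
      have h := forestCount_mul m (b + 1)
      have hden : 2 * (m : ℝ) - b - 2 ≠ 0 := by
        have : (b : ℝ) + 2 ≤ m := by exact_mod_cast hb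
        have : (0 : ℝ) ≤ b := b.cast_nonneg
        linarith
      push_cast at h
      field_simp
      linear_combination -2 * h
    have hb' : (b : ℝ) + 1 ≠ 0 := by positivity
    have ih := ih (b.lt_succ_self.trans hb)
    rw [pow_succ, Finset.prod_range_succ]
    refine mul_left_cancel₀ hb' ?_
    push_cast
    linear_combination 2 ^ b * hrec + (b + 2) * (1 - (b : ℝ) / (2 * m - b - 2)) * ih

theorem two_pow_mul_forestCount_mem_Icc (m b : ℕ) :
    2 ^ b * forestCount m (b + 1) ∈ Set.Icc 0 ((b + 1) * forestCount m 1) := by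
  have hpos : 0 ≤ (b + 1) * forestCount m 1 := by
    rw [forestCount_one]
    positivity
  obtain hmb | hbm := le_or_gt m b
  · rwa [forestCount_eq_zero_of_lt (Nat.lt_succ_of_le hmb), mul_zero, Set.left_mem_Icc]
  have hfactor {j : ℕ} (hj : j ∈ Finset.range b) : (j : ℝ) / (2 * m - j - 2) ∈ Set.Icc 0 1 := by
    have hj' : (j : ℝ) + 1 ≤ b := by exact_mod_cast Finset.mem_range.1 hj
    have hbm' : (b : ℝ) + 1 ≤ m := by exact_mod_cast hbm
    exact ⟨div_nonneg j.cast_nonneg (by linarith [j.cast_nonneg (α := ℝ)]),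
      div_le_one_of_le₀ (by linarith) (by linarith [j.cast_nonneg (α := ℝ)])⟩
  rw [two_pow_mul_forestCount hbm]
  exact ⟨mul_nonneg hpos (Finset.prod_nonneg fun j hj => sub_nonneg.2 (hfactor hj).2),
    mul_le_of_le_one_right hpos (Finset.prod_le_one (fun j hj => sub_nonneg.2 (hfactor hj).2)
      fun j hj => sub_le_self _ (hfactor hj).1)⟩

theorem four_pow_mul_forestCount_one_mul_sq_le {m : ℕ} (hm : 1 ≤ m) (s : ℕ) :
    4 ^ s * forestCount m 1 * (m : ℝ) ^ 2 ≤ forestCount (m + s) 1 * ((m : ℝ) + s) ^ 2 := by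
  induction s with
  | zero => simp
  | succ s ih =>
    have hms : 1 ≤ m + s := hm.trans (Nat.le_add_right m s)
    have hrec := forestCount_succ_one_mul hms
    have hms' : (1 : ℝ) ≤ m + s := by exact_mod_cast hms
    have hpos := forestCount_one_pos hms
    push_cast at hrec ⊢
    calc 4 ^ (s + 1) * forestCount m 1 * (m : ℝ) ^ 2
        = 4 * (4 ^ s * forestCount m 1 * (m : ℝ) ^ 2) := by ring
      _ ≤ 4 * (forestCount (m + s) 1 * ((m : ℝ) + s) ^ 2) := by gcongr
      _ ≤ forestCount (m + s) 1 * (4 * ((m : ℝ) + s) - 2) * (m + s + 1) := by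
        linarith [mul_nonneg hpos.le (sub_nonneg.2 hms')]
      _ = forestCount (m + (s + 1)) 1 * ((m : ℝ) + (s + 1)) ^ 2 := by
        rw [← hrec, ← add_assoc m s 1]
        ring

/-- The ratio of the number of forests of `b + 1` plane trees with `n - s` vertices to its leading
order approximation in terms of the number of plane trees with `n` vertices. -/
noncomputable def forestRatio (n s b : ℕ) : ℝ :=
  4 ^ s * 2 ^ b * forestCount (n - s) (b + 1) / ((b + 1) * forestCount n 1)

theorem forestRatio_nonneg (n s b : ℕ) : 0 ≤ forestRatio n s b := by
  refine div_nonneg ?_ (by rw [forestCount_one]; positivity)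
  rw [mul_assoc]
  exact mul_nonneg (by positivity) (two_pow_mul_forestCount_mem_Icc (n - s) b).1

theorem forestRatio_eq_zero_of_le {n s : ℕ} (h : n ≤ s) (b : ℕ) : forestRatio n s b = 0 := by
  rw [forestRatio, forestCount_eq_zero_of_lt (by lia), mul_zero, zero_div]

theorem forestRatio_eq_prod {m s b : ℕ} (hb : b < m) :
    forestRatio (m + s) s b =
      (∏ i ∈ Finset.range s, (1 + 3 / (2 * ((m : ℝ) + i) - 1))) *
        ∏ j ∈ Finset.range b, (1 - (j : ℝ) / (2 * m - j - 2)) := by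
  have hm : 1 ≤ m := Nat.one_le_of_lt hb
  have hpos := forestCount_one_pos (hm.trans (Nat.le_add_right m s))
  rw [forestRatio, Nat.add_sub_cancel, mul_assoc, two_pow_mul_forestCount hb,
    div_eq_iff (by positivity)]
  linear_combination (b + 1) * (∏ j ∈ Finset.range b, (1 - (j : ℝ) / (2 * m - j - 2))) *
    four_pow_mul_forestCount_one hm s

theorem forestRatio_mul_sq_le (n s b : ℕ) :
    forestRatio n s b * (n : ℝ) ^ 2 ≤ ((n : ℝ) + s + s ^ 2) ^ 2 := by
  obtain hns | hsn := le_or_gt n s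
  · rw [forestRatio_eq_zero_of_le hns, zero_mul]
    positivity
  obtain ⟨m, rfl⟩ := Nat.exists_eq_add_of_le' hsn.le
  have hm : 1 ≤ m := by lia
  have hm' : (1 : ℝ) ≤ m := by exact_mod_cast hm
  have hpos := forestCount_one_pos (hm.trans (Nat.le_add_right m s))
  have hle : forestRatio (m + s) s b ≤ ((m : ℝ) + s) ^ 2 / m ^ 2 := by
    have htwo := (two_pow_mul_forestCount_mem_Icc m b).2
    have hfour := four_pow_mul_forestCount_one_mul_sq_le hm s
    rw [forestRatio, Nat.add_sub_cancel, div_le_div_iff₀ (by positivity) (by positivity)]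
    calc 4 ^ s * 2 ^ b * forestCount m (b + 1) * (m : ℝ) ^ 2
        = 4 ^ s * (2 ^ b * forestCount m (b + 1)) * (m : ℝ) ^ 2 := by ring
      _ ≤ 4 ^ s * ((b + 1) * forestCount m 1) * (m : ℝ) ^ 2 := by gcongr
      _ = (b + 1) * (4 ^ s * forestCount m 1 * (m : ℝ) ^ 2) := by ring
      _ ≤ (b + 1) * (forestCount (m + s) 1 * ((m : ℝ) + s) ^ 2) := by gcongr
      _ = _ := by ring
  have hdiv : ((m : ℝ) + s) ^ 2 / m ≤ m + s + s + s ^ 2 := by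
    rw [div_le_iff₀ (by linarith)]
    nlinarith [mul_nonneg (sq_nonneg (s : ℝ)) (sub_nonneg.2 hm')]
  push_cast
  calc forestRatio (m + s) s b * ((m : ℝ) + s) ^ 2
      ≤ ((m : ℝ) + s) ^ 2 / m ^ 2 * ((m : ℝ) + s) ^ 2 := by gcongr
    _ = (((m : ℝ) + s) ^ 2 / m) ^ 2 := by ring
    _ ≤ _ := by gcongr

/-- The expansion of `forestRatio n s b` up to terms of order `1 / n`. -/
noncomputable def forestRatioApprox (n s b : ℕ) : ℝ :=
  1 + 3 * s / (2 * n) - b * (b - 1) / (4 * n)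

theorem abs_forestRatio_sub_le_of_sq_le {n s b : ℕ} (h : 2 * (s + b + 1) ^ 2 ≤ n) :
    |forestRatio n s b - forestRatioApprox n s b| ≤
      2 * (((s : ℝ) + b + 1) ^ 4 / n ^ 2) := by
  have hlinear : 2 * s + 2 * b + 2 ≤ n := by nlinarith
  obtain ⟨m, rfl⟩ := Nat.exists_eq_add_of_le' (show s ≤ n by lia)
  have h' : 2 * ((s : ℝ) + b + 1) ^ 2 ≤ m + s := by exact_mod_cast h
  have happrox : forestRatioApprox (m + s) s b =
      1 + (3 * s - (b : ℝ) * (b - 1) / 2) / (2 * (m + s)) := by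
    have : (m : ℝ) + s ≠ 0 :=
      ((by positivity : (0 : ℝ) < 2 * ((s : ℝ) + b + 1) ^ 2).trans_le h').ne'
    rw [forestRatioApprox]
    push_cast
    field_simp
    ring
  rw [forestRatio_eq_prod (by lia), happrox]
  exact_mod_cast abs_prod_mul_prod_sub_le h'

theorem abs_forestRatioApprox_mul_sq_le {n s b : ℕ} (hn : 1 ≤ n) (h : n ≤ 2 * (s + b + 1) ^ 2) :
    |forestRatioApprox n s b| * n ^ 2 ≤ 8 * ((s : ℝ) + b + 1) ^ 4 := by
  have hn' : (0 : ℝ) < n := by exact_mod_cast hn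
  have : (0 : ℝ) ≤ s := s.cast_nonneg
  have : (0 : ℝ) ≤ b := b.cast_nonneg
  have hnL : (n : ℝ) ≤ 2 * ((s : ℝ) + b + 1) ^ 2 := by exact_mod_cast h
  set L : ℝ := (s : ℝ) + b + 1
  have hsL : |3 * (s : ℝ) / 2| ≤ 3 / 2 * L ^ 2 := by
    rw [abs_of_nonneg (by positivity)]
    nlinarith
  have hbL : |-((b : ℝ) * (b - 1) / 4)| ≤ 1 / 4 * L ^ 2 := by
    rw [abs_neg, abs_le]
    constructor <;> nlinarith
  have heq : forestRatioApprox n s b * n ^ 2 =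
      (n + 3 * s / 2 + -((b : ℝ) * (b - 1) / 4)) * n := by
    rw [forestRatioApprox]
    field_simp
    ring
  rw [← abs_of_nonneg (sq_nonneg (n : ℝ)), ← abs_mul, heq, abs_mul, abs_of_pos hn']
  calc |n + 3 * s / 2 + -((b : ℝ) * (b - 1) / 4)| * n
      ≤ (2 * L ^ 2 + 3 / 2 * L ^ 2 + 1 / 4 * L ^ 2) * (2 * L ^ 2) := by
        gcongr
        exact (abs_add_three _ _ _).trans
          (add_le_add_three ((abs_of_pos hn').trans_le hnL) hsL hbL)
    _ ≤ 8 * L ^ 4 := by linarith [show (0 : ℝ) ≤ L ^ 4 by positivity]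

theorem abs_forestRatio_sub_le_of_le_sq {n s b : ℕ} (hn : 1 ≤ n) (h : n ≤ 2 * (s + b + 1) ^ 2) :
    |forestRatio n s b - forestRatioApprox n s b| ≤
      17 * (((s : ℝ) + b + 1) ^ 4 / n ^ 2) := by
  have hsq : (0 : ℝ) < (n : ℝ) ^ 2 := by
    have : (0 : ℝ) < n := by exact_mod_cast hn
    positivity
  have hnL : (n : ℝ) ≤ 2 * ((s : ℝ) + b + 1) ^ 2 := by exact_mod_cast h
  have hsL : (s : ℝ) + s ^ 2 ≤ ((s : ℝ) + b + 1) ^ 2 := by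
    nlinarith [s.cast_nonneg (α := ℝ), b.cast_nonneg (α := ℝ)]
  have hratio : |forestRatio n s b| * (n : ℝ) ^ 2 ≤ 9 * ((s : ℝ) + b + 1) ^ 4 := by
    rw [abs_of_nonneg (forestRatio_nonneg n s b)]
    calc forestRatio n s b * (n : ℝ) ^ 2 ≤ ((n : ℝ) + s + s ^ 2) ^ 2 := forestRatio_mul_sq_le n s b
      _ ≤ (3 * ((s : ℝ) + b + 1) ^ 2) ^ 2 :=
        pow_le_pow_left₀ (by positivity) (by linarith) 2
      _ = 9 * ((s : ℝ) + b + 1) ^ 4 := by ring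
  rw [← mul_div_assoc, le_div_iff₀ hsq]
  calc |forestRatio n s b - forestRatioApprox n s b| * (n : ℝ) ^ 2
      ≤ (|forestRatio n s b| + |forestRatioApprox n s b|) * (n : ℝ) ^ 2 := by
        gcongr
        exact abs_sub _ _
    _ ≤ 17 * ((s : ℝ) + b + 1) ^ 4 := by
        linarith [abs_forestRatioApprox_mul_sq_le hn h]

theorem abs_forestRatio_sub_le {n : ℕ} (hn : 1 ≤ n) (s b : ℕ) :
    |forestRatio n s b - forestRatioApprox n s b| ≤ 17 * (((s : ℝ) + b + 1) ^ 4 / n ^ 2) := by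
  obtain h | h := le_total (2 * (s + b + 1) ^ 2) n
  · refine (abs_forestRatio_sub_le_of_sq_le h).trans ?_
    gcongr
    norm_num
  · exact abs_forestRatio_sub_le_of_le_sq hn h

/-! ### Protection probabilities -/

-- For `n < s` the truncated difference is harmless, as `forestCount 0 b = 0` for `b ≠ 0`.
theorem coeff_X_pow_mul_protectedSeries_pow (n s : ℕ) {b : ℕ} (hb : b ≠ 0) :
    coeff n (X ^ s * protectedSeries ℝ 0 ^ b) = forestCount (n - s) b := by
  rw [coeff_X_pow_mul']
  split_ifs with h
  · rfl
  · rw [forestCount_eq_zero_of_lt (by lia)]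

theorem hasSum_numProtected_add_two (n k : ℕ) :
    HasSum (fun m : ℕ => (-1) ^ m * (forestCount (n - (m + 1) * k) (3 * (m + 1)) -
      forestCount (n - ((m + 1) * k + 1)) (3 * (m + 1)))) (numProtected n (k + 2) : ℝ) := by
  set R : ℝ⟦X⟧ := protectedSeries ℝ 0
  have hterm (m : ℕ) : coeff n ((-1) ^ m * ((1 - X) * (X ^ k * R ^ 3) ^ (m + 1))) =
      (-1) ^ m * (forestCount (n - (m + 1) * k) (3 * (m + 1)) -
        forestCount (n - ((m + 1) * k + 1)) (3 * (m + 1))) := by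
    rw [← coeff_X_pow_mul_protectedSeries_pow _ _ (by lia),
      ← coeff_X_pow_mul_protectedSeries_pow _ _ (by lia), ← map_sub,
      show (-1 : ℝ⟦X⟧) ^ m = C ((-1 : ℝ) ^ m) by rw [map_pow, map_neg, map_one], coeff_C_mul]
    congr 2
    ring
  have htail : coeff n ((-(X ^ k * R ^ 3)) ^ (n + 1) * protectedSeries ℝ (k + 2)) = 0 := by
    have hX : X ∣ -(X ^ k * R ^ 3) :=
      ((dvd_pow (X_dvd_protectedSeries ℝ 0) three_ne_zero).mul_left _).neg_right
    exact X_pow_dvd_iff.1 ((pow_dvd_pow_of_dvd hX _).mul_right _) n n.lt_succ_self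
  have hsum : (numProtected n (k + 2) : ℝ) = _ :=
    (coeff_protectedSeries ℝ n (k + 2)).symm.trans <| congrArg (coeff n) <|
      eq_sum_range_add_of_one_add_mul_eq (one_add_X_pow_mul_cube_mul_protectedSeries ℝ k) (n + 1)
  rw [hsum, map_add, htail, add_zero, map_sum, Finset.sum_congr rfl fun m _ => hterm m]
  refine hasSum_sum_of_ne_finset_zero fun m hm => ?_
  have hm' : n + 1 ≤ m := by simpa using hm
  rw [forestCount_eq_zero_of_lt (by lia), forestCount_eq_zero_of_lt (by lia), sub_zero, mul_zero]

theorem forestCount_div_forestCount_one (n s b : ℕ) :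
    forestCount (n - s) (b + 1) / forestCount n 1 =
      (b + 1) * (1 / (4 ^ s * 2 ^ b)) * forestRatio n s b := by
  have hb : (b : ℝ) + 1 ≠ 0 := by positivity
  rw [forestRatio]
  field_simp

/-- The contribution of `(-1) ^ m * (1 - X) * (X ^ k * R ^ 3) ^ (m + 1)`, where `R` is the
generating function of the plane trees, to the probability that a random plane tree with `n`
vertices is `(k + 2)`-protected. -/
noncomputable def protectionTerm (n k m : ℕ) : ℝ :=
  6 * (m + 1) * (-1) ^ m * (1 / (8 * 4 ^ k)) ^ (m + 1) *
    (forestRatio n ((m + 1) * k) (3 * m + 2) - forestRatio n ((m + 1) * k + 1) (3 * m + 2) / 4)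

theorem hasSum_protectionTerm (n k : ℕ) :
    HasSum (protectionTerm n k) ((numProtected n (k + 2) : ℝ) / numProtected n 0) := by
  have hpow (m : ℕ) : 1 / ((4 : ℝ) ^ ((m + 1) * k) * 2 ^ (3 * m + 2)) =
      2 * (1 / (8 * 4 ^ k)) ^ (m + 1) := by
    rw [one_div_pow, mul_pow, ← pow_mul, mul_comm k, show (8 : ℝ) = 2 ^ 3 by norm_num, ← pow_mul]
    field_simp
    ring
  have hterm (m s : ℕ) : forestCount (n - s) (3 * (m + 1)) / forestCount n 1 =
      3 * (m + 1) * (1 / (4 ^ s * 2 ^ (3 * m + 2))) * forestRatio n s (3 * m + 2) := by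
    rw [show 3 * (m + 1) = 3 * m + 2 + 1 by ring, forestCount_div_forestCount_one]
    push_cast
    ring
  rw [← forestCount_one]
  convert! (hasSum_numProtected_add_two n k).div_const (forestCount n 1) using 2 with m
  rw [protectionTerm, mul_div_assoc, sub_div, hterm, hterm, pow_succ (4 : ℝ),
    mul_right_comm ((4 : ℝ) ^ _) 4, ← div_div _ _ (4 : ℝ), hpow]
  ring

/-- The expansion of the probability that a random plane tree with `n` vertices is `k`-protected up
to terms of order `1 / n`. -/
noncomputable def probApprox (n k : ℕ) : ℝ :=
  9 * (4 : ℝ) ^ k / ((4 : ℝ) ^ k + 2) ^ 2 +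
    9 * (4 : ℝ) ^ k *
        ((3 * (k : ℝ) - 8) * (4 : ℝ) ^ (2 * k) + 28 * (4 : ℝ) ^ k - (12 * (k : ℝ) + 20)) /
      (2 * ((4 : ℝ) ^ k + 2) ^ 4) * (1 / (n : ℝ))

/-- The expansion of `protectionTerm n k m` up to terms of order `1 / n`. -/
noncomputable def protectionTermApprox (n k m : ℕ) : ℝ :=
  6 * (m + 1) * (-1) ^ m * (1 / (8 * 4 ^ k)) ^ (m + 1) *
    (forestRatioApprox n ((m + 1) * k) (3 * m + 2) -
      forestRatioApprox n ((m + 1) * k + 1) (3 * m + 2) / 4)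

theorem hasSum_protectionTermApprox (n k : ℕ) :
    HasSum (protectionTermApprox n k) (probApprox n (k + 2)) := by
  set q : ℝ := 4 ^ k with hq
  have hq1 : 1 ≤ q := one_le_pow₀ (by norm_num)
  set u : ℝ := -(1 / (8 * q)) with hu
  have hu1 : ‖u‖ < 1 := by
    rw [hu, norm_neg, Real.norm_of_nonneg (by positivity), div_lt_one (by positivity)]
    linarith
  have hpow (m : ℕ) : (-1) ^ m * (1 / (8 * q)) ^ (m + 1) = -u * u ^ m := by
    rw [hu, neg_pow (1 / (8 * q)) m]
    ring
  have hone := (hasSum_add_one_mul_geometric_of_norm_lt_one hu1).mul_left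
    (-u * (9 / 2 - 9 / (2 * n)))
  have htwo := (hasSum_add_one_sq_mul_geometric_of_norm_lt_one hu1).mul_left
    (-u * (9 / (8 * n) * (6 * k + 9)))
  have hthree := (hasSum_add_one_pow_three_mul_geometric_of_norm_lt_one hu1).mul_left
    (-u * (-81 / (8 * n)))
  convert! (hone.add htwo).add hthree using 2 with m
  · rw [protectionTermApprox, ← hq, mul_assoc (6 * _), hpow, forestRatioApprox, forestRatioApprox]
    push_cast
    ring
  · rw [probApprox, hu, show (4 : ℝ) ^ (2 * (k + 2)) = (16 * q) ^ 2 by rw [hq]; ring,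
      show (4 : ℝ) ^ (k + 2) = 16 * q by rw [hq]; ring]
    have h1 : 16 * q + 2 ≠ 0 := by positivity
    have h2 : 1 - -(1 / (8 * q)) = (16 * q + 2) / (16 * q) := by
      field_simp
      ring
    rw [h2]
    push_cast
    field_simp
    ring

theorem abs_forestRatio_sub_forestRatio_sub_le {n : ℕ} (hn : 1 ≤ n) (k m : ℕ) :
    |(forestRatio n ((m + 1) * k) (3 * m + 2) - forestRatio n ((m + 1) * k + 1) (3 * m + 2) / 4) -
      (forestRatioApprox n ((m + 1) * k) (3 * m + 2) -
        forestRatioApprox n ((m + 1) * k + 1) (3 * m + 2) / 4)| ≤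
      22 * ((((m : ℝ) + 1) * (k + 4)) ^ 4 / n ^ 2) := by
  have hle (s : ℕ) (hs : s ≤ (m + 1) * k + 1) :
      |forestRatio n s (3 * m + 2) - forestRatioApprox n s (3 * m + 2)| ≤
        17 * ((((m : ℝ) + 1) * (k + 4)) ^ 4 / n ^ 2) := by
    refine (abs_forestRatio_sub_le hn s (3 * m + 2)).trans ?_
    gcongr
    have : (s : ℝ) ≤ (m + 1) * k + 1 := by exact_mod_cast hs
    push_cast
    linarith [m.cast_nonneg (α := ℝ)]
  have h₁ := abs_le.1 (hle ((m + 1) * k) (Nat.le_succ _))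
  have h₂ := abs_le.1 (hle ((m + 1) * k + 1) le_rfl)
  have : 0 ≤ (((m : ℝ) + 1) * (k + 4)) ^ 4 / (n : ℝ) ^ 2 := by positivity
  rw [abs_le]
  constructor <;> linarith

theorem norm_protectionTerm_sub_le {n : ℕ} (hn : 1 ≤ n) (k m : ℕ) :
    ‖protectionTerm n k m - protectionTermApprox n k m‖ ≤
      132 * (((k : ℝ) + 4) ^ 4 / (4 ^ k * n ^ 2)) * (((m : ℝ) + 1) ^ 5 * (1 / 8) ^ (m + 1)) := by
  have : (0 : ℝ) < n := by exact_mod_cast hn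
  have hpow : (1 / (8 * 4 ^ k) : ℝ) ^ (m + 1) ≤ (1 / 8) ^ (m + 1) * (1 / 4 ^ k) := by
    rw [← one_div_mul_one_div, mul_pow]
    gcongr
    exact pow_le_of_le_one (by positivity)
      (div_le_one_of_le₀ (one_le_pow₀ (by norm_num)) (by positivity)) m.succ_ne_zero
  have hcoeff : ‖6 * ((m : ℝ) + 1) * (-1) ^ m * (1 / (8 * 4 ^ k)) ^ (m + 1)‖ ≤
      6 * ((m : ℝ) + 1) * ((1 / 8) ^ (m + 1) * (1 / 4 ^ k)) := by
    rw [norm_mul, norm_mul, norm_pow, norm_neg, norm_one, one_pow, mul_one,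
      Real.norm_of_nonneg (by positivity), Real.norm_of_nonneg (by positivity)]
    gcongr
  rw [protectionTerm, protectionTermApprox, ← mul_sub, norm_mul]
  calc _ ≤ 6 * ((m : ℝ) + 1) * ((1 / 8) ^ (m + 1) * (1 / 4 ^ k)) *
          (22 * ((((m : ℝ) + 1) * (k + 4)) ^ 4 / n ^ 2)) :=
        mul_le_mul hcoeff (abs_forestRatio_sub_forestRatio_sub_le hn k m) (abs_nonneg _)
          (by positivity)
    _ = 132 * (((k : ℝ) + 4) ^ 4 / (4 ^ k * n ^ 2)) * (((m : ℝ) + 1) ^ 5 * (1 / 8) ^ (m + 1)) := by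
        field_simp
        ring

theorem exists_abs_numProtected_add_two_div_sub_le :
    ∃ C : ℝ, 0 ≤ C ∧ ∀ n : ℕ, 1 ≤ n → ∀ k : ℕ,
      |(numProtected n (k + 2) : ℝ) / numProtected n 0 - probApprox n (k + 2)| ≤
        C * (((k : ℝ) + 4) ^ 4 / (4 ^ k * n ^ 2)) := by
  have hsummable : Summable fun m : ℕ => ((m : ℝ) + 1) ^ 5 * (1 / 8) ^ (m + 1) := by
    have h := (summable_nat_add_iff (f := fun m : ℕ => (m : ℝ) ^ 5 * (1 / 8) ^ m) 1).2
      (summable_pow_mul_geometric_of_norm_lt_one 5 (by norm_num))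
    simpa only [Nat.cast_add, Nat.cast_one] using h
  refine ⟨132 * ∑' m : ℕ, ((m : ℝ) + 1) ^ 5 * (1 / 8) ^ (m + 1),
    mul_nonneg (by norm_num) (tsum_nonneg fun m => by positivity), fun n hn k => ?_⟩
  have hdiff := (hasSum_protectionTerm n k).sub (hasSum_protectionTermApprox n k)
  rw [← hdiff.tsum_eq, ← Real.norm_eq_abs]
  refine (tsum_of_norm_bounded (hsummable.hasSum.mul_left _) fun m =>
    norm_protectionTerm_sub_le hn k m).trans_eq ?_
  ring

theorem probApprox_zero (n : ℕ) : probApprox n 0 = 1 := by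
  norm_num [probApprox]

theorem probApprox_one (n : ℕ) : probApprox n 1 = 1 := by
  norm_num [probApprox]

theorem abs_numProtected_one_div_sub_one_le {n : ℕ} (hn : 1 ≤ n) :
    |(numProtected n 1 : ℝ) / numProtected n 0 - 1| ≤ 1 / (n : ℝ) ^ 2 := by
  have hpos : (0 : ℝ) < numProtected n 0 := forestCount_one n ▸ forestCount_one_pos hn
  have hadd : (numProtected n 0 : ℝ) = (if n = 1 then 1 else 0) + numProtected n 1 := by
    have h := congrArg (PowerSeries.coeff n) (protectedSeries_zero_eq ℝ)
    rwa [map_add, PowerSeries.coeff_X, coeff_protectedSeries, coeff_protectedSeries] at h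
  split_ifs at hadd with h
  · subst h
    have hone : (numProtected 1 0 : ℝ) = 1 := forestCount_one 1 ▸ forestCount_one_one
    have hzero : (numProtected 1 1 : ℝ) = 0 := by linarith
    norm_num [hone, hzero]
  · rw [zero_add] at hadd
    rw [← hadd, div_self hpos.ne', sub_self, abs_zero]
    positivity

theorem exists_abs_numProtected_div_sub_probApprox_le :
    ∃ C : ℝ, 0 ≤ C ∧ ∀ n : ℕ, 1 ≤ n → ∀ k : ℕ,
      |(numProtected n k : ℝ) / numProtected n 0 - probApprox n k| ≤
        C * ((k : ℝ) ^ 4 / (4 ^ k * n ^ 2)) := by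
  obtain ⟨C, hC, hbound⟩ := exists_abs_numProtected_add_two_div_sub_le
  refine ⟨256 * C + 4, by positivity, fun n hn k => ?_⟩
  have : (0 : ℝ) < n := by exact_mod_cast hn
  match k with
  | 0 =>
    have hpos : (0 : ℝ) < numProtected n 0 := forestCount_one n ▸ forestCount_one_pos hn
    rw [probApprox_zero, div_self hpos.ne', sub_self, abs_zero]
    positivity
  | 1 =>
    rw [probApprox_one]
    refine (abs_numProtected_one_div_sub_one_le hn).trans ?_
    have : 0 ≤ 1 / (n : ℝ) ^ 2 := by positivity
    rw [Nat.cast_one, one_pow, pow_one, ← one_div_mul_one_div]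
    nlinarith
  | k + 2 =>
    refine (hbound n hn k).trans ?_
    push_cast
    calc C * (((k : ℝ) + 4) ^ 4 / (4 ^ k * n ^ 2))
        ≤ C * ((2 * ((k : ℝ) + 2)) ^ 4 / (4 ^ k * n ^ 2)) := by
          gcongr
          linarith [k.cast_nonneg (α := ℝ)]
      _ = 256 * C * (((k : ℝ) + 2) ^ 4 / (4 ^ (k + 2) * n ^ 2)) := by
          field_simp
          ring
      _ ≤ (256 * C + 4) * (((k : ℝ) + 2) ^ 4 / (4 ^ (k + 2) * n ^ 2)) := by
          gcongr
          linarith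

theorem uniformTree_real_le_protectionNumber (n k : ℕ) :
    (uniformTree n).real {t | k ≤ t.protectionNumber} =
      (numProtected n k : ℝ) / numProtected n 0 := by
  have hinter (j : ℕ) : {t ∈ ofSize n | t.IsProtected j} =
      ofSize n ∩ {t | j ≤ t.protectionNumber} := by
    simp only [isProtected_iff]
    rfl
  have huniv : {t : PlaneTree | 0 ≤ t.protectionNumber} = Set.univ := by simp
  rw [uniformTree, uniformOn_real_eq_ncard_div (finite_ofSize n), numProtected, numProtected,
    hinter, hinter, huniv, Set.inter_univ]

end PlaneTree

theorem mainTheorem3_general :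
    (∃ C : ℝ, 0 ≤ C ∧ ∀ n : ℕ, 1 ≤ n → ∀ k : ℕ,
      |(PlaneTree.uniformTree n).real {t : PlaneTree | k ≤ t.protectionNumber} -
          PlaneTree.probApprox n k| ≤ C * ((k : ℝ) ^ 4 / ((4 : ℝ) ^ k * (n : ℝ) ^ 2))) ∧
    (∀ z : ℂ, z ≠ 0 → ‖z‖ ≤ 1 / 4 → ∀ R₀ : ℂ, R₀ = (1 - (1 - 4 * z) ^ (1 / 2 : ℂ)) / 2 →
      HasSum (fun n : ℕ => (PlaneTree.numProtected n 0 : ℂ) * z ^ n) R₀ ∧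
      ∀ k : ℕ, 1 ≤ k →
        1 + z ^ ((k : ℤ) - 2) * R₀ ^ 3 ≠ 0 ∧
        HasSum (fun n : ℕ => (PlaneTree.numProtected n k : ℂ) * z ^ n)
          ((1 - z) * z ^ ((k : ℤ) - 2) * R₀ ^ 3 / (1 + z ^ ((k : ℤ) - 2) * R₀ ^ 3))) := by
  refine ⟨?_, fun z hz0 hz R₀ hR₀ => ?_⟩
  · simpa only [PlaneTree.uniformTree_real_le_protectionNumber] using
      PlaneTree.exists_abs_numProtected_div_sub_probApprox_le
  have hz1 : z ≠ 1 := by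
    rintro rfl
    norm_num at hz
  rw [hR₀, ← PlaneTree.protectedGF_zero_eq hz]
  refine ⟨PlaneTree.hasSum_protectedGF hz 0, fun k hk => ?_⟩
  obtain ⟨hne, heq⟩ := (PlaneTree.isProtectionSequence_protectedGF
    hz).one_add_zpow_mul_cube_ne_zero_and_eq hz0 hz1 hk
  exact ⟨hne, heq ▸ PlaneTree.hasSum_protectedGF hz k⟩

theorem mainTheorem3 :
    (∃ C : ℝ, ∀ n : ℕ, 1 ≤ n → ∀ k : ℕ,
      |(PlaneTree.uniformTree n).real {t : PlaneTree | k ≤ t.protectionNumber} -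
          (9 * (4 : ℝ) ^ k / ((4 : ℝ) ^ k + 2) ^ 2 +
            9 * (4 : ℝ) ^ k *
                ((3 * (k : ℝ) - 8) * (4 : ℝ) ^ (2 * k) + 28 * (4 : ℝ) ^ k - (12 * (k : ℝ) + 20)) /
              (2 * ((4 : ℝ) ^ k + 2) ^ 4) * (1 / (n : ℝ)))| ≤
        C * ((k : ℝ) ^ 2 / ((3 : ℝ) ^ k * (n : ℝ) ^ (3 / 2 : ℝ)))) ∧
    (∀ z : ℂ, z ≠ 0 → ‖z‖ < 1 / 4 → ∀ R₀ : ℂ, R₀ = (1 - (1 - 4 * z) ^ (1 / 2 : ℂ)) / 2 →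
      HasSum (fun n : ℕ => (PlaneTree.numProtected n 0 : ℂ) * z ^ n) R₀ ∧
      ∀ k : ℕ, 1 ≤ k →
        1 + z ^ ((k : ℤ) - 2) * R₀ ^ 3 ≠ 0 ∧
        HasSum (fun n : ℕ => (PlaneTree.numProtected n k : ℂ) * z ^ n)
          ((1 - z) * z ^ ((k : ℤ) - 2) * R₀ ^ 3 / (1 + z ^ ((k : ℤ) - 2) * R₀ ^ 3))) := by
  obtain ⟨⟨C, hC, hprob⟩, hgf⟩ := mainTheorem3_general
  obtain ⟨D, hD⟩ := exists_pow_four_div_four_pow_mul_sq_le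
  refine ⟨⟨C * D, fun n hn k => (hprob n hn k).trans ?_⟩, fun z hz0 hz => hgf z hz0 hz.le⟩
  exact (mul_le_mul_of_nonneg_left (hD n hn k) hC).trans_eq (mul_assoc C D _).symm
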